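/- Let $\delta>0$ and let $X$ be a geodesic metric space that is $\delta$-hyperbolic (every geodesic triangle is $\delta$-thin: each side lies in the closed $\delta$-neighbourhood of the union of the other two) and a visibility space (any two distinct points of the Gromov boundary $\partial X$ are the endpoints of a bi-infinite geodesic). For an isometry $A$ of $X$ let $l_S(A)=\lim_{n\to\infty}\frac1n d(A^nx,x)$ be its stable norm (which does not depend on $x\in X$), and call $A$ hyperbolic if $(A^nx)_{n\in\mathbb Z}$ is a quasi-geodesic for some (equivalently, every) $x\in X$. Let $\mathbb F_2$ be the free group of rank two; an element of $\mathbb F_2$ is primitive if it belongs to a free basis, and $\mathcal P(\mathbb F_2)$ denotes the set of classes $[\gamma]$ of primitive elements up to conjugacy and inversion. Let $\rho:\mathbb F_2\to\mathrm{Isom}(X)$ be a representation satisfying condition (BQa): - for every $[\gamma]\in\mathcal P(\mathbb F_2)$, $\rho(\gamma)$ is hyperbolic, and - the set $\{[\gamma]\in\mathcal P(\mathbb F_2) : l_S(\rho(\gamma))\le 433\,\delta\}$ is finite. Then $\rho$ is irreducible: there is no point of $\partial X$ that is fixed by $\rho(\gamma)$ for all $\gamma\in\mathbb F_2$. -/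

import Mathlib

open Filter Topology

noncomputable section

namespace Bowditch

/-! ## Geodesic, hyperbolic and visibility spaces -/

section Spaces

variable {X : Type*} [MetricSpace X]

/-- `S` is (the image of) a geodesic segment joining `x` to `y`. -/
def IsGeodesicSegment (S : Set X) (x y : X) : Prop :=
  ∃ c : ℝ → X,
    (∀ s ∈ Set.Icc 0 (dist x y), ∀ t ∈ Set.Icc 0 (dist x y), dist (c s) (c t) = |s - t|) ∧
    c 0 = x ∧ c (dist x y) = y ∧ S = c '' Set.Icc 0 (dist x y)

variable (X) in
/-- Any two points are joined by a geodesic segment. -/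
def IsGeodesicSpace : Prop :=
  ∀ x y : X, ∃ S : Set X, IsGeodesicSegment S x y

/-- `S` is contained in the (closed) `δ`-neighbourhood of `T`. -/
def InNeighborhood (δ : ℝ) (S T : Set X) : Prop :=
  ∀ p ∈ S, ∃ q ∈ T, dist p q ≤ δ

variable (X) in
/-- Hyperbolicity in the sense of Rips: every geodesic triangle is `δ`-thin. -/
def IsRipsHyperbolic (δ : ℝ) : Prop :=
  ∀ (x y z : X) (S T U : Set X),
    IsGeodesicSegment S x y → IsGeodesicSegment T y z → IsGeodesicSegment U z x →
    InNeighborhood δ S (T ∪ U) ∧ InNeighborhood δ T (U ∪ S) ∧ InNeighborhood δ U (S ∪ T)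

/-- The Gromov product `(x|y)_z`. -/
def gromovProduct (z x y : X) : ℝ :=
  (dist z x + dist z y - dist x y) / 2

/-- The sequence `u` converges at infinity: `(u n | u m)_z → +∞` as `n, m → ∞`
(for one, equivalently every, base point `z`). -/
def ConvergesAtInfinity (u : ℕ → X) : Prop :=
  ∀ z : X, Tendsto (fun p : ℕ × ℕ => gromovProduct z (u p.1) (u p.2)) atTop atTop

variable (X) in
/-- The sequences converging at infinity. -/
def InfinitySeq : Type _ := {u : ℕ → X // ConvergesAtInfinity u}

/-- Two sequences converging at infinity are equivalent when `(u n | v n)_z → +∞`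
(for one, equivalently every, base point `z`). -/
def SeqEquiv (u v : InfinitySeq X) : Prop :=
  ∀ z : X, Tendsto (fun n : ℕ => gromovProduct z (u.1 n) (v.1 n)) atTop atTop

variable (X) in
/-- The Gromov boundary `∂X`: sequences converging at infinity up to equivalence. The relation
`SeqEquiv` is an equivalence relation as soon as `X` is hyperbolic. -/
def GromovBoundary : Type _ := Quot (SeqEquiv (X := X))

/-- `u` converges to the boundary point `ξ`, i.e. `u` belongs to the class `ξ`. -/
def TendsToBoundary (u : ℕ → X) (ξ : GromovBoundary X) : Prop :=
  ∃ h : ConvergesAtInfinity u, (Quot.mk _ ⟨u, h⟩ : GromovBoundary X) = ξ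

variable (X) in
/-- Any two distinct boundary points are the endpoints of a bi-infinite geodesic. -/
def IsVisibilitySpace : Prop :=
  ∀ ξ η : GromovBoundary X, ξ ≠ η →
    ∃ l : ℝ → X, Isometry l ∧
      TendsToBoundary (fun n : ℕ => l n) ξ ∧ TendsToBoundary (fun n : ℕ => l (-(n : ℝ))) η

theorem gromovProduct_isometry (A : X ≃ᵢ X) (z x y : X) :
    gromovProduct z (A x) (A y) = gromovProduct (A.symm z) x y := by
  have h : ∀ w : X, dist z (A w) = dist (A.symm z) w := fun w => by
    rw [← A.dist_eq (A.symm z) w, A.apply_symm_apply]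
  simp only [gromovProduct, h, A.dist_eq]

/-- The action of an isometry on sequences converging at infinity. -/
def InfinitySeq.map (A : X ≃ᵢ X) (u : InfinitySeq X) : InfinitySeq X :=
  ⟨fun n => A (u.1 n), fun z => by
    simpa only [gromovProduct_isometry] using u.2 (A.symm z)⟩

/-- The action of an isometry on the Gromov boundary. -/
def GromovBoundary.map (A : X ≃ᵢ X) : GromovBoundary X → GromovBoundary X :=
  Quot.map (InfinitySeq.map A) fun u v h z => by
    simpa only [InfinitySeq.map, gromovProduct_isometry] using h (A.symm z)

/-! ## Isometries -/

/-- `A` is hyperbolic: the orbit `n ↦ A ^ n x`, `n ∈ ℤ`, is a quasi-geodesic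
(for one, equivalently every, `x`). -/
def IsHyperbolicIsometry (A : X ≃ᵢ X) : Prop :=
  ∃ x : X, ∃ C : ℝ, 1 ≤ C ∧ ∃ D : ℝ, 0 ≤ D ∧ ∀ m n : ℤ,
    |(m : ℝ) - n| / C - D ≤ dist ((A ^ m) x) ((A ^ n) x) ∧
    dist ((A ^ m) x) ((A ^ n) x) ≤ C * |(m : ℝ) - n| + D

/-- The stable norm `l_S(A) = lim d(A ^ n x, x) / n`. By `tendsto_stableNorm` the limit exists
and does not depend on `x`. -/
def stableNorm [Nonempty X] (A : X ≃ᵢ X) : ℝ :=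
  limUnder atTop fun n : ℕ =>
    dist ((A ^ n) (Classical.arbitrary X)) (Classical.arbitrary X) / n

theorem exists_tendsto_dist_div (A : X ≃ᵢ X) (x : X) :
    ∃ L : ℝ, Tendsto (fun n : ℕ => dist ((A ^ n) x) x / n) atTop (𝓝 L) := by
  have hs : Subadditive fun n : ℕ => dist ((A ^ n) x) x := fun m n => by
    have h1 : dist ((A ^ (m + n)) x) ((A ^ m) x) = dist ((A ^ n) x) x := by
      rw [pow_add, IsometryEquiv.mul_apply, (A ^ m).dist_eq]
    have h2 := dist_triangle ((A ^ (m + n)) x) ((A ^ m) x) x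
    show dist ((A ^ (m + n)) x) x ≤ dist ((A ^ m) x) x + dist ((A ^ n) x) x
    linarith
  refine ⟨_, hs.tendsto_lim ⟨0, ?_⟩⟩
  rintro _ ⟨n, rfl⟩
  positivity

theorem tendsto_stableNorm [Nonempty X] (A : X ≃ᵢ X) (x : X) :
    Tendsto (fun n : ℕ => dist ((A ^ n) x) x / n) atTop (𝓝 (stableNorm A)) := by
  set o : X := Classical.arbitrary X with ho
  have h0 : Tendsto (fun n : ℕ => dist ((A ^ n) o) o / n) atTop (𝓝 (stableNorm A)) :=
    tendsto_nhds_limUnder (exists_tendsto_dist_div A o)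
  have hc : Tendsto (fun n : ℕ => (2 * dist x o) / (n : ℝ)) atTop (𝓝 0) :=
    tendsto_const_div_atTop_nhds_zero_nat _
  refine h0.congr_dist (squeeze_zero (fun _ => dist_nonneg) (fun n => ?_) hc)
  rw [Real.dist_eq, ← sub_div, abs_div, Nat.abs_cast]
  gcongr
  have h1 : dist ((A ^ n) o) ((A ^ n) x) = dist o x := (A ^ n).dist_eq o x
  have h2 := dist_triangle4 ((A ^ n) o) ((A ^ n) x) x o
  have h3 := dist_triangle4 ((A ^ n) x) ((A ^ n) o) o x
  rw [dist_comm ((A ^ n) x) ((A ^ n) o)] at h3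
  rw [dist_comm o x] at h1 h3
  rw [abs_le]
  constructor <;> linarith

/-- A representation is irreducible if it fixes no point of the Gromov boundary. -/
def IsIrreducible {Γ : Type*} [Group Γ] (ρ : Γ →* (X ≃ᵢ X)) : Prop :=
  ¬ ∃ ξ : GromovBoundary X, ∀ γ : Γ, GromovBoundary.map (ρ γ) ξ = ξ

end Spaces

/-! ## Primitive elements of the free group of rank two -/

/-- The free group of rank two. -/
abbrev F₂ : Type := FreeGroup (Fin 2)

/-- `γ` belongs to some free basis of `F₂` (all of which have two elements). -/
def IsPrimitive (γ : F₂) : Prop :=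
  ∃ b : FreeGroupBasis (Fin 2) F₂, γ ∈ Set.range b

/-- Primitive elements are identified up to conjugacy and inversion. -/
def primitiveSetoid : Setoid {γ : F₂ // IsPrimitive γ} where
  r γ γ' := IsConj γ.1 γ'.1 ∨ IsConj γ.1 γ'.1⁻¹
  iseqv := by
    have hinv : ∀ {a b : F₂}, IsConj a b → IsConj a⁻¹ b⁻¹ := fun {a b} h => by
      obtain ⟨c, hc⟩ := isConj_iff.1 h
      exact isConj_iff.2 ⟨c, by rw [← hc]; group⟩
    refine ⟨fun γ => Or.inl (IsConj.refl _), ?_, ?_⟩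
    · rintro γ γ' (h | h)
      · exact Or.inl h.symm
      · exact Or.inr (by simpa using hinv h.symm)
    · rintro γ γ' γ'' (h | h) (h' | h')
      · exact Or.inl (h.trans h')
      · exact Or.inr (h.trans h')
      · exact Or.inr (h.trans (hinv h'))
      · exact Or.inl (h.trans (by simpa using hinv h'))

/-- The set `P(F₂)` of conjugacy and inversion classes of primitive elements. -/
def PrimitiveClass : Type := Quotient primitiveSetoid

/-- Condition (BQa), with the constant `K_δ = 433 δ`: primitive elements are sent to hyperbolic
isometries, and only finitely many classes of primitive elements have stable norm at most `K_δ`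
(the stable norm of `ρ γ` only depends on the class of `γ`). -/
def SatisfiesBQa {X : Type*} [MetricSpace X] [Nonempty X] (δ : ℝ) (ρ : F₂ →* (X ≃ᵢ X)) : Prop :=
  (∀ γ : F₂, IsPrimitive γ → IsHyperbolicIsometry (ρ γ)) ∧
  {c : PrimitiveClass | ∃ γ : {γ : F₂ // IsPrimitive γ},
    Quotient.mk primitiveSetoid γ = c ∧ stableNorm (ρ γ.1) ≤ 433 * δ}.Finite

end Bowditch

end

/-! Suppose `ρ` fixes a boundary point. Its Busemann cocycle is invariant under `ρ` up to a bounded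
error, so the Busemann displacement of a base point is a quasimorphism on `F₂`. Let `β` be its
homogenization, of defect D. The stable norm is at most |β| (`IsGromovHyperbolic.stableNorm_le`), so
`β` vanishes on no primitive element, these being hyperbolic.

For any K > D such a `β` is at most K in absolute value on infinitely many primitive classes
(`IsQuasimorphism.infinite_primitiveClass`), which contradicts (BQa). Indeed, take a basis (x, y)
with β x > 0 > β y lying beyond any finite set of classes. While |β| > K on both entries, replacing
x or y by xy, according to the sign of β (xy), keeps the signs opposite and shrinks β x - β y by at
least K - D. This cannot go on forever. -/

namespace Bowditch

/-! ### Thin triangles and the four point condition -/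

section Segments

variable {X : Type*} [MetricSpace X]

theorem IsGeodesicSegment.symm {S : Set X} {x y : X} (h : IsGeodesicSegment S x y) :
    IsGeodesicSegment S y x := by
  obtain ⟨c, hc, h0, h1, rfl⟩ := h
  refine ⟨fun t => c (dist x y - t), ?_, by simpa using h1, by simpa [dist_comm y x] using h0, ?_⟩
  · intro s hs t ht
    rw [dist_comm y x] at hs ht
    rw [hc _ ⟨by linarith [hs.2], by linarith [hs.1]⟩ _ ⟨by linarith [ht.2], by linarith [ht.1]⟩,
      abs_sub_comm]
    congr 1
    ring
  · ext p
    constructor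
    · rintro ⟨t, ht, rfl⟩
      refine ⟨dist x y - t, ?_, by simp⟩
      rw [dist_comm y x]
      exact ⟨by linarith [ht.2], by linarith [ht.1]⟩
    · rintro ⟨t, ht, rfl⟩
      rw [dist_comm y x] at ht
      exact ⟨dist x y - t, ⟨by linarith [ht.2], by linarith [ht.1]⟩, rfl⟩

theorem IsGeodesicSegment.left_mem {S : Set X} {x y : X} (h : IsGeodesicSegment S x y) :
    x ∈ S := by
  obtain ⟨c, -, h0, -, rfl⟩ := h
  exact ⟨0, ⟨le_rfl, dist_nonneg⟩, h0⟩

theorem IsGeodesicSegment.dist_add_dist {S : Set X} {x y p : X} (h : IsGeodesicSegment S x y)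
    (hp : p ∈ S) : dist x p + dist p y = dist x y := by
  obtain ⟨c, hc, h0, h1, rfl⟩ := h
  obtain ⟨t, ht, rfl⟩ := hp
  have e0 := hc 0 ⟨le_rfl, dist_nonneg⟩ t ht
  have e1 := hc t ht _ ⟨dist_nonneg, le_rfl⟩
  rw [h0, zero_sub, abs_neg, abs_of_nonneg ht.1] at e0
  rw [h1, abs_sub_comm, abs_of_nonneg (by linarith [ht.2])] at e1
  linarith

/-- A geodesic segment has a continuous parametrization by a compact interval. -/
theorem IsGeodesicSegment.exists_continuousOn {S : Set X} {x y : X}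
    (h : IsGeodesicSegment S x y) :
    ∃ c : ℝ → X, ContinuousOn c (Set.Icc 0 (dist x y)) ∧ S = c '' Set.Icc 0 (dist x y) := by
  obtain ⟨c, hc, -, -, rfl⟩ := h
  refine ⟨c, ?_, rfl⟩
  have : LipschitzOnWith 1 c (Set.Icc 0 (dist x y)) :=
    LipschitzOnWith.of_dist_le_mul fun s hs t ht => by
      rw [hc s hs t ht, Real.dist_eq]; simp
  exact this.continuousOn

theorem IsGeodesicSegment.isCompact {S : Set X} {x y : X} (h : IsGeodesicSegment S x y) :
    IsCompact S := by
  obtain ⟨c, hc, rfl⟩ := h.exists_continuousOn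
  exact isCompact_Icc.image_of_continuousOn hc

theorem IsGeodesicSegment.isPreconnected {S : Set X} {x y : X} (h : IsGeodesicSegment S x y) :
    IsPreconnected S := by
  obtain ⟨c, hc, rfl⟩ := h.exists_continuousOn
  exact isPreconnected_Icc.image c hc

/-- The Gromov product bounds the distance to a geodesic segment from below. -/
theorem IsGeodesicSegment.gromovProduct_le_dist {S : Set X} {x y p : X}
    (h : IsGeodesicSegment S x y) (hp : p ∈ S) (w : X) : gromovProduct w x y ≤ dist w p := by
  have e := h.dist_add_dist hp
  have h1 := dist_triangle w p x
  have h2 := dist_triangle w p y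
  rw [dist_comm p x] at h1
  unfold gromovProduct
  linarith

theorem isClosed_setOf_infDist_le (T : Set X) (δ : ℝ) :
    IsClosed {p : X | Metric.infDist p T ≤ δ} :=
  isClosed_le (Metric.continuous_infDist_pt T) continuous_const

/-- In a thin triangle, some point of a side is close to both of the other sides. -/
theorem IsRipsHyperbolic.exists_near_both {δ : ℝ} (hδ : 0 ≤ δ) (h : IsRipsHyperbolic X δ)
    {x y w : X} {S T U : Set X} (hS : IsGeodesicSegment S x y) (hT : IsGeodesicSegment T y w)
    (hU : IsGeodesicSegment U w x) :
    ∃ p ∈ S, (∃ q ∈ T, dist p q ≤ δ) ∧ ∃ r ∈ U, dist p r ≤ δ := by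
  have hthin := (h x y w S T U hS hT hU).1
  have near : ∀ {V : Set X} {a b : X}, IsGeodesicSegment V a b → ∀ {p : X},
      Metric.infDist p V ≤ δ → ∃ q ∈ V, dist p q ≤ δ := fun hV p hp => by
    obtain ⟨q, hq, he⟩ := hV.isCompact.exists_infDist_eq_dist ⟨_, hV.left_mem⟩ p
    exact ⟨q, hq, he ▸ hp⟩
  -- The closed neighbourhoods of the two other sides cover the connected side, and each contains an
  -- endpoint of it, so they meet on it.
  obtain ⟨p, hp, hpT, hpU⟩ := isPreconnected_closed_iff.1 hS.isPreconnected _ _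
    (isClosed_setOf_infDist_le T δ) (isClosed_setOf_infDist_le U δ)
    (fun p hp => by
      obtain ⟨q, hq | hq, hpq⟩ := hthin p hp
      · exact Or.inl ((Metric.infDist_le_dist_of_mem hq).trans hpq)
      · exact Or.inr ((Metric.infDist_le_dist_of_mem hq).trans hpq))
    ⟨y, hS.symm.left_mem, by
      show Metric.infDist y T ≤ δ
      rwa [Metric.infDist_zero_of_mem hT.left_mem]⟩
    ⟨x, hS.left_mem, by
      show Metric.infDist x U ≤ δ
      rwa [Metric.infDist_zero_of_mem hU.symm.left_mem]⟩
  exact ⟨p, hp, near hT hpT, near hU hpU⟩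

variable (X) in
/-- Hyperbolicity in the sense of Gromov: the four point condition. -/
def IsGromovHyperbolic (d : ℝ) : Prop :=
  ∀ w x y z : X, min (gromovProduct w x y) (gromovProduct w y z) - d ≤ gromovProduct w x z

/-- A point p of [x, z] close to both [z, w] and [w, x] has d(w, p) ≤ (x|z)_w + 2δ. Thinness of the
triangle x, z, y puts p within δ of [x, y] or [y, z], whose distance to w is at least the
corresponding Gromov product. -/
theorem IsRipsHyperbolic.isGromovHyperbolic {δ : ℝ} (hδ : 0 ≤ δ) (hgeo : IsGeodesicSpace X)
    (h : IsRipsHyperbolic X δ) : IsGromovHyperbolic X (3 * δ) := by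
  intro w x y z
  obtain ⟨S, hS⟩ := hgeo x z
  obtain ⟨T, hT⟩ := hgeo z w
  obtain ⟨U, hU⟩ := hgeo w x
  obtain ⟨V, hV⟩ := hgeo z y
  obtain ⟨W, hW⟩ := hgeo y x
  obtain ⟨p, hp, ⟨q, hq, hpq⟩, r, hr, hpr⟩ := h.exists_near_both hδ hS hT hU
  have hwp : dist w p ≤ gromovProduct w x z + 2 * δ := by
    have e1 := hT.dist_add_dist hq
    have e2 := hU.dist_add_dist hr
    have e3 := hS.dist_add_dist hp
    have t1 := dist_triangle z q p
    have t2 := dist_triangle p q w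
    have t3 := dist_triangle w r p
    have t4 := dist_triangle p r x
    rw [dist_comm q p] at t1
    rw [dist_comm r p] at t3
    rw [dist_comm p w] at t2
    rw [dist_comm p x] at t4
    rw [dist_comm p z] at e3
    unfold gromovProduct
    rw [dist_comm w z]
    linarith
  obtain ⟨q', hq', hpq'⟩ := (h x z y S V W hS hV hW).1 p hp
  have t := dist_triangle w p q'
  rcases hq' with hq' | hq'
  · have := hV.symm.gromovProduct_le_dist hq' w
    linarith [min_le_right (gromovProduct w x y) (gromovProduct w y z)]
  · have := hW.symm.gromovProduct_le_dist hq' w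
    linarith [min_le_left (gromovProduct w x y) (gromovProduct w y z)]

end Segments

/-! ### Busemann cocycles and their almost invariance -/

section Busemann

variable {X : Type*} [MetricSpace X]

theorem gromovProduct_comm (z x y : X) : gromovProduct z x y = gromovProduct z y x := by
  simp only [gromovProduct, dist_comm x y]
  ring

/-- Equality in the `Quot` defining the boundary only gives the generated equivalence relation;
transitivity, from the four point condition, recovers `SeqEquiv` itself. -/
theorem IsGromovHyperbolic.seqEquiv_equivalence {d : ℝ} (h : IsGromovHyperbolic X d) :
    Equivalence (SeqEquiv (X := X)) where
  refl u z := (u.2 z).comp (tendsto_atTop_diagonal)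
  symm {u v} huv z := by simpa only [gromovProduct_comm] using huv z
  trans {u v w} huv hvw z := by
    refine tendsto_atTop_mono (fun n => h z (u.1 n) (v.1 n) (w.1 n)) ?_
    refine tendsto_atTop_add_const_right _ _ (tendsto_atTop.2 fun b => ?_)
    filter_upwards [(huv z).eventually_ge_atTop b, (hvw z).eventually_ge_atTop b] with n h1 h2
    exact le_min h1 h2

theorem IsGromovHyperbolic.seqEquiv_of_mk_eq {d : ℝ} (h : IsGromovHyperbolic X d)
    {u v : InfinitySeq X} (huv : (Quot.mk SeqEquiv u : GromovBoundary X) = Quot.mk SeqEquiv v) :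
    SeqEquiv u v :=
  h.seqEquiv_equivalence.eqvGen_iff.1 (Quot.eqvGen_exact huv)

/-- The Busemann cocycle of a sequence, defined as a limit along an ultrafilter. -/
noncomputable def busemann (u : ℕ → X) (x y : X) : ℝ :=
  limUnder (hyperfilter ℕ : Filter ℕ) fun n => dist x (u n) - dist y (u n)

/-- The differences stay in a compact interval, so they converge along an ultrafilter even if not
along ℕ. The limit keeps the cocycle identity exact. -/
theorem tendsto_busemann (u : ℕ → X) (x y : X) :
    Tendsto (fun n => dist x (u n) - dist y (u n)) (hyperfilter ℕ) (𝓝 (busemann u x y)) := by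
  refine tendsto_nhds_limUnder ?_
  obtain ⟨b, -, hb⟩ := (isCompact_Icc (a := -dist x y) (b := dist x y)).ultrafilter_le_nhds'
    ((hyperfilter ℕ).map fun n => dist x (u n) - dist y (u n))
    (Filter.mem_map.2 (Filter.Eventually.of_forall fun n =>
      abs_le.1 (abs_dist_sub_le x y (u n))))
  exact ⟨b, hb⟩

theorem busemann_add (u : ℕ → X) (x y z : X) :
    busemann u x y + busemann u y z = busemann u x z :=
  tendsto_nhds_unique (((tendsto_busemann u x y).add (tendsto_busemann u y z)).congr
    fun n => by ring) (tendsto_busemann u x z)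

theorem busemann_map (A : X ≃ᵢ X) (u : ℕ → X) (x y : X) :
    busemann (fun n => A (u n)) (A x) (A y) = busemann u x y := by
  simp only [busemann, A.dist_eq]

/-- Equivalent sequences have Busemann cocycles at bounded distance. -/
theorem IsGromovHyperbolic.abs_busemann_sub_le {d : ℝ} (h : IsGromovHyperbolic X d)
    {u v : InfinitySeq X} (huv : SeqEquiv u v) (x y : X) :
    |busemann u.1 x y - busemann v.1 x y| ≤ 2 * d := by
  refine le_of_tendsto ((tendsto_busemann u.1 x y).sub (tendsto_busemann v.1 x y)).abs ?_
  refine ((huv x).eventually_gt_atTop (dist x y + |d|)).filter_mono Nat.hyperfilter_le_atTop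
    |>.mono fun n hn => ?_
  set p := u.1 n
  set q := v.1 n
  have t1 := dist_triangle x y p
  have t2 := dist_triangle x y q
  have h1 := h x y p q
  have h2 := h x y q p
  have hd := le_abs_self d
  have hd' := neg_abs_le d
  simp only [gromovProduct, dist_comm q p] at h1 h2 hn
  rw [abs_le]
  constructor
  · rcases le_total ((dist x y + dist x q - dist y q) / 2) ((dist x q + dist x p - dist p q) / 2)
      with hm | hm
    · rw [min_eq_left hm] at h2
      linarith
    · rw [min_eq_right hm] at h2
      linarith
  · rcases le_total ((dist x y + dist x p - dist y p) / 2) ((dist x p + dist x q - dist p q) / 2)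
      with hm | hm
    · rw [min_eq_left hm] at h1
      linarith
    · rw [min_eq_right hm] at h1
      linarith

/-- The Busemann cocycle is almost invariant under the stabilizer of the boundary point. -/
theorem IsGromovHyperbolic.abs_busemann_map_sub_le {d : ℝ} (h : IsGromovHyperbolic X d)
    {u : InfinitySeq X} {A : X ≃ᵢ X}
    (hA : GromovBoundary.map A (Quot.mk SeqEquiv u) = Quot.mk SeqEquiv u) (x y : X) :
    |busemann u.1 (A x) (A y) - busemann u.1 x y| ≤ 2 * d := by
  have hs : SeqEquiv (InfinitySeq.map A u) u := h.seqEquiv_of_mk_eq hA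
  have := h.abs_busemann_sub_le hs (A x) (A y)
  rwa [show busemann (InfinitySeq.map A u).1 (A x) (A y) = busemann u.1 x y from
    busemann_map A u.1 x y, abs_sub_comm] at this

/-- Doubling an isometry adds to the displacement only the Busemann shift and a constant. This is
the four point condition based at A x for x, u n, A² x, in the limit; almost invariance compares the
shifts from x to A x and from A x to A² x. -/
theorem IsGromovHyperbolic.dist_apply_apply_le {d : ℝ} (h : IsGromovHyperbolic X d)
    {u : InfinitySeq X} {A : X ≃ᵢ X}
    (hA : GromovBoundary.map A (Quot.mk SeqEquiv u) = Quot.mk SeqEquiv u) (x : X) :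
    dist (A (A x)) x ≤ dist (A x) x + |busemann u.1 (A x) x| + 4 * d := by
  have hi := abs_le.1 (h.abs_busemann_map_sub_le hA (A x) x)
  have key : min ((dist (A x) x + busemann u.1 (A x) x) / 2)
      ((dist (A x) x - busemann u.1 (A (A x)) (A x)) / 2) - d ≤
      gromovProduct (A x) x (A (A x)) := by
    refine le_of_tendsto
      (((((tendsto_busemann u.1 (A x) x).const_add (dist (A x) x)).div_const 2).min
        (((tendsto_busemann u.1 (A (A x)) (A x)).const_sub (dist (A x) x)).div_const 2)).sub_const
          d) (Filter.Eventually.of_forall fun n => ?_)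
    have e1 : (dist (A x) x + (dist (A x) (u.1 n) - dist x (u.1 n))) / 2 =
        gromovProduct (A x) x (u.1 n) := by
      simp only [gromovProduct]; ring
    have e2 : (dist (A x) x - (dist (A (A x)) (u.1 n) - dist (A x) (u.1 n))) / 2 =
        gromovProduct (A x) (u.1 n) (A (A x)) := by
      simp only [gromovProduct, A.dist_eq, dist_comm (u.1 n), dist_comm x (A x)]; ring
    have := h (A x) x (u.1 n) (A (A x))
    rwa [← e1, ← e2] at this
  have hb := le_abs_self (busemann u.1 (A x) x)
  have hb' := neg_abs_le (busemann u.1 (A x) x)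
  have hd : 0 ≤ d := by linarith
  simp only [gromovProduct, A.dist_eq, dist_comm x] at key
  rcases le_total ((dist (A x) x + busemann u.1 (A x) x) / 2)
      ((dist (A x) x - busemann u.1 (A (A x)) (A x)) / 2) with hm | hm
  · rw [min_eq_left hm] at key
    linarith
  · rw [min_eq_right hm] at key
    linarith

end Busemann

/-! ### Quasimorphisms and homogenization -/

section Quasimorphism

variable {G : Type*} [Group G]

/-- `f` is a quasimorphism of defect at most `D`. -/
def IsQuasimorphism (f : G → ℝ) (D : ℝ) : Prop :=
  ∀ g h : G, |f (g * h) - f g - f h| ≤ D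

theorem IsQuasimorphism.abs_pow_sub_le {f : G → ℝ} {D : ℝ} (hf : IsQuasimorphism f D) (g : G)
    (n : ℕ) : |f (g ^ n) - n * f g| ≤ (n + 1) * D := by
  induction n with
  | zero => simpa [abs_sub_comm] using hf 1 1
  | succ n ih =>
    have h1 := abs_le.1 (hf (g ^ n) g)
    have h2 := abs_le.1 ih
    rw [pow_succ, abs_le]
    push_cast
    constructor <;> linarith

/-- Adding D makes n ↦ f (g ^ n) subadditive, so Fekete's lemma applies, and D / n vanishes in the
limit. -/
theorem IsQuasimorphism.exists_tendsto {f : G → ℝ} {D : ℝ} (hf : IsQuasimorphism f D) (g : G) :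
    ∃ L, Tendsto (fun n : ℕ => f (g ^ n) / n) atTop (𝓝 L) := by
  have hD : 0 ≤ D := (abs_nonneg _).trans (hf 1 1)
  have hs : Subadditive fun n : ℕ => f (g ^ n) + D := fun m n => by
    have := abs_le.1 (hf (g ^ m) (g ^ n))
    rw [← pow_add] at this
    show f (g ^ (m + n)) + D ≤ f (g ^ m) + D + (f (g ^ n) + D)
    linarith
  refine ⟨hs.lim, ?_⟩
  have hl := hs.tendsto_lim ⟨-|f g| - 2 * D, ?_⟩
  · have hc : Tendsto (fun n : ℕ => D / (n : ℝ)) atTop (𝓝 0) :=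
      tendsto_const_div_atTop_nhds_zero_nat _
    have := hl.sub hc
    rw [sub_zero] at this
    exact this.congr fun n => by ring
  · rintro _ ⟨n, rfl⟩
    rcases Nat.eq_zero_or_pos n with rfl | hn
    · simp only [Nat.cast_zero, div_zero]
      linarith [abs_nonneg (f g)]
    · have hn' : (1 : ℝ) ≤ n := by exact_mod_cast hn
      rw [le_div_iff₀ (by positivity)]
      have h1 := (abs_le.1 (hf.abs_pow_sub_le g n)).1
      have h2 := mul_le_mul_of_nonneg_left (neg_abs_le (f g)) (by positivity : (0 : ℝ) ≤ n)
      have h3 := mul_le_mul_of_nonneg_right hn' hD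
      linarith

/-- The homogenization `lim f (g ^ n) / n` of a quasimorphism. -/
noncomputable def homogenization (f : G → ℝ) (g : G) : ℝ :=
  limUnder atTop fun n : ℕ => f (g ^ n) / n

theorem IsQuasimorphism.tendsto_homogenization {f : G → ℝ} {D : ℝ} (hf : IsQuasimorphism f D)
    (g : G) : Tendsto (fun n : ℕ => f (g ^ n) / n) atTop (𝓝 (homogenization f g)) :=
  tendsto_nhds_limUnder (hf.exists_tendsto g)

theorem IsQuasimorphism.abs_homogenization_sub_le {f : G → ℝ} {D : ℝ} (hf : IsQuasimorphism f D)
    (g : G) : |homogenization f g - f g| ≤ D := by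
  have hc : Tendsto (fun n : ℕ => D + D / (n : ℝ)) atTop (𝓝 (D + 0)) :=
    (tendsto_const_div_atTop_nhds_zero_nat D).const_add D
  rw [add_zero] at hc
  refine le_of_tendsto_of_tendsto ((hf.tendsto_homogenization g).sub_const (f g)).abs hc ?_
  filter_upwards [eventually_gt_atTop 0] with n hn
  have hn' : (0 : ℝ) < n := by exact_mod_cast hn
  have := hf.abs_pow_sub_le g n
  rw [show f (g ^ n) / n - f g = (f (g ^ n) - n * f g) / n by field_simp,
    show D + D / n = (n + 1) * D / n by field_simp, abs_div, abs_of_pos hn']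
  gcongr

theorem IsQuasimorphism.homogenization_pow {f : G → ℝ} {D : ℝ} (hf : IsQuasimorphism f D)
    (g : G) (k : ℕ) : homogenization f (g ^ k) = k * homogenization f g := by
  rcases Nat.eq_zero_or_pos k with rfl | hk
  · have h := hf.tendsto_homogenization (g ^ 0)
    simp only [pow_zero, one_pow] at h
    simpa using tendsto_nhds_unique h (tendsto_const_div_atTop_nhds_zero_nat (f 1))
  · have hk' : (k : ℝ) ≠ 0 := by exact_mod_cast hk.ne'
    have h := ((hf.tendsto_homogenization g).comp
      (tendsto_id.const_mul_atTop' hk)).const_mul (k : ℝ)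
    refine tendsto_nhds_unique (hf.tendsto_homogenization (g ^ k)) (h.congr fun n => ?_)
    simp only [Function.comp_apply, id_eq, ← pow_mul, Nat.cast_mul]
    rw [← mul_div_assoc, mul_div_mul_left _ _ hk']

theorem IsQuasimorphism.homogenization_inv {f : G → ℝ} {D : ℝ} (hf : IsQuasimorphism f D)
    (g : G) : homogenization f g⁻¹ = -homogenization f g := by
  rw [eq_neg_iff_add_eq_zero]
  refine tendsto_nhds_unique
    ((hf.tendsto_homogenization g⁻¹).add (hf.tendsto_homogenization g)) ?_
  refine squeeze_zero_norm (fun n => ?_) (tendsto_const_div_atTop_nhds_zero_nat (2 * D))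
  have h1 := abs_le.1 (hf (g⁻¹ ^ n) (g ^ n))
  have h2 := abs_le.1 (hf 1 1)
  rw [inv_pow, inv_mul_cancel] at h1
  rw [mul_one] at h2
  rw [← add_div, Real.norm_eq_abs, abs_div, Nat.abs_cast, inv_pow]
  gcongr
  rw [abs_le]
  constructor <;> linarith

/-- One D is the defect of `f`; the other three are the costs of replacing `f` by its homogenization
at g, h and gh. -/
theorem IsQuasimorphism.isQuasimorphism_homogenization {f : G → ℝ} {D : ℝ}
    (hf : IsQuasimorphism f D) : IsQuasimorphism (homogenization f) (4 * D) := by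
  intro g h
  have h1 := abs_le.1 (hf g h)
  have h2 := abs_le.1 (hf.abs_homogenization_sub_le g)
  have h3 := abs_le.1 (hf.abs_homogenization_sub_le h)
  have h4 := abs_le.1 (hf.abs_homogenization_sub_le (g * h))
  rw [abs_le]
  constructor <;> linarith

end Quasimorphism

end Bowditch

namespace Bowditch

/-! ### Stable norms when a boundary point is fixed -/

section BoundaryFixing

variable {X : Type*} [MetricSpace X] {Γ : Type*} [Group Γ]

/-- By the cocycle identity, the defect is exactly the failure of invariance under ρ g. -/
theorem IsGromovHyperbolic.isQuasimorphism_busemann {d : ℝ} (h : IsGromovHyperbolic X d)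
    {u : InfinitySeq X} {ρ : Γ →* (X ≃ᵢ X)}
    (hρ : ∀ γ, GromovBoundary.map (ρ γ) (Quot.mk SeqEquiv u) = Quot.mk SeqEquiv u) (x : X) :
    IsQuasimorphism (fun γ => busemann u.1 (ρ γ x) x) (2 * d) := by
  intro g k
  have h1 := h.abs_busemann_map_sub_le (hρ g) (ρ k x) x
  have h2 := busemann_add u.1 (ρ g (ρ k x)) (ρ g x) x
  simp only [map_mul, IsometryEquiv.mul_apply]
  rw [← h2]
  convert h1 using 2
  ring

/-- If `ρ` fixes a boundary point, the stable norm of `ρ γ` is controlled by the homogenized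
Busemann quasimorphism. -/
theorem IsGromovHyperbolic.stableNorm_le [Nonempty X] {d : ℝ} (h : IsGromovHyperbolic X d)
    {u : InfinitySeq X} {ρ : Γ →* (X ≃ᵢ X)}
    (hρ : ∀ γ, GromovBoundary.map (ρ γ) (Quot.mk SeqEquiv u) = Quot.mk SeqEquiv u) (x : X)
    (γ : Γ) :
    stableNorm (ρ γ) ≤ |homogenization (fun γ => busemann u.1 (ρ γ x) x) γ| := by
  set f : Γ → ℝ := fun γ => busemann u.1 (ρ γ x) x with hf
  set β := homogenization f
  have hq : IsQuasimorphism f (2 * d) := h.isQuasimorphism_busemann hρ x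
  -- Along powers of two the error is paid once per doubling, so it is linear in k and disappears
  -- after division by 2 ^ k. Each payment is 4d from `dist_apply_apply_le` plus 2d for comparing f
  -- with β.
  have bound : ∀ k : ℕ, dist ((ρ γ ^ 2 ^ k) x) x ≤
      dist (ρ γ x) x + 2 ^ k * |β γ| + k * (6 * d) := by
    intro k
    induction k with
    | zero => simp
    | succ k ih =>
      have h1 := h.dist_apply_apply_le (hρ (γ ^ 2 ^ k)) x
      have h2 := hq.abs_homogenization_sub_le (γ ^ 2 ^ k)
      have h3 := hq.homogenization_pow γ (2 ^ k)
      have h4 : |f (γ ^ 2 ^ k)| ≤ 2 ^ k * |β γ| + 2 * d := by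
        have e : |homogenization f (γ ^ 2 ^ k)| = 2 ^ k * |β γ| := by
          rw [h3, abs_mul]; simp [β]
        rw [← e]
        have := abs_sub_abs_le_abs_sub (f (γ ^ 2 ^ k)) (homogenization f (γ ^ 2 ^ k))
        rw [abs_sub_comm] at this
        linarith
      have h5 : ρ (γ ^ 2 ^ k) (ρ (γ ^ 2 ^ k) x) = (ρ γ ^ 2 ^ (k + 1)) x := by
        rw [← IsometryEquiv.mul_apply, ← map_mul, ← pow_add, map_pow, pow_succ, mul_two]
      rw [h5] at h1
      rw [map_pow] at h1
      have h6 : busemann u.1 ((ρ γ ^ 2 ^ k) x) x = f (γ ^ 2 ^ k) := by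
        simp only [hf, map_pow]
      rw [h6] at h1
      push_cast
      rw [pow_succ (2 : ℝ)]
      linarith
  have hpow : Tendsto (fun k : ℕ => 2 ^ k) atTop (atTop : Filter ℕ) :=
    tendsto_pow_atTop_atTop_of_one_lt one_lt_two
  have hl := (tendsto_stableNorm (ρ γ) x).comp hpow
  have e1 : Tendsto (fun k : ℕ => dist (ρ γ x) x / (2 : ℝ) ^ k) atTop (𝓝 0) :=
    tendsto_const_nhds.div_atTop (tendsto_pow_atTop_atTop_of_one_lt one_lt_two)
  have e2 : Tendsto (fun k : ℕ => (k : ℝ) / (2 : ℝ) ^ k * (6 * d)) atTop (𝓝 (0 * (6 * d))) :=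
    Tendsto.mul_const _
      (by simpa using tendsto_pow_const_div_const_pow_of_one_lt 1 (one_lt_two (α := ℝ)))
  have hr := (e1.add_const |β γ|).add e2
  rw [zero_mul, zero_add, add_zero] at hr
  refine le_of_tendsto_of_tendsto' hl hr fun k => ?_
  have h2 : (0 : ℝ) < 2 ^ k := by positivity
  simp only [Function.comp_apply, Nat.cast_pow, Nat.cast_ofNat]
  rw [div_le_iff₀ h2]
  refine (bound k).trans_eq ?_
  field_simp

theorem IsHyperbolicIsometry.stableNorm_pos [Nonempty X] {A : X ≃ᵢ X}
    (hA : IsHyperbolicIsometry A) : 0 < stableNorm A := by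
  obtain ⟨x, C, hC, D, hD, h⟩ := hA
  have hC' : 0 < C := by linarith
  refine lt_of_lt_of_le (one_div_pos.2 hC') ?_
  have hc := (tendsto_const_div_atTop_nhds_zero_nat D).const_sub (1 / C)
  rw [sub_zero] at hc
  refine le_of_tendsto_of_tendsto hc (tendsto_stableNorm A x) ?_
  filter_upwards [eventually_gt_atTop 0] with n hn
  have hn' : (0 : ℝ) < n := by exact_mod_cast hn
  have := (h n 0).1
  simp only [Int.cast_natCast, Int.cast_zero, sub_zero, Nat.abs_cast, zpow_natCast,
    zpow_zero, IsometryEquiv.coe_one, id_eq] at this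
  rw [le_div_iff₀ hn']
  refine le_trans (le_of_eq ?_) this
  field_simp

end BoundaryFixing

/-! ## Bases of the free group of rank two -/

section FreeGroup

/-- `(x, y)` is a free basis of `F₂`. -/
def IsBasisPair (x y : F₂) : Prop :=
  ∃ e : F₂ ≃* F₂, e (FreeGroup.of 0) = x ∧ e (FreeGroup.of 1) = y

theorem isBasisPair_of : IsBasisPair (FreeGroup.of 0) (FreeGroup.of 1) :=
  ⟨MulEquiv.refl _, rfl, rfl⟩

theorem IsBasisPair.isPrimitive_left {x y : F₂} (h : IsBasisPair x y) : IsPrimitive x := by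
  obtain ⟨e, rfl, -⟩ := h
  exact ⟨(FreeGroupBasis.ofFreeGroup (Fin 2)).map e, 0, by simp⟩

theorem IsBasisPair.isPrimitive_right {x y : F₂} (h : IsBasisPair x y) : IsPrimitive y := by
  obtain ⟨e, -, rfl⟩ := h
  exact ⟨(FreeGroupBasis.ofFreeGroup (Fin 2)).map e, 1, by simp⟩

/-- A change of basis, given by its values and those of its inverse on the standard basis. -/
theorem IsBasisPair.change {x y : F₂} (h : IsBasisPair x y) (p q : F₂ × F₂)
    (h1 : FreeGroup.lift ![p.1, p.2] q.1 = FreeGroup.of (0 : Fin 2))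
    (h2 : FreeGroup.lift ![p.1, p.2] q.2 = FreeGroup.of (1 : Fin 2))
    (h3 : FreeGroup.lift ![q.1, q.2] p.1 = FreeGroup.of (0 : Fin 2))
    (h4 : FreeGroup.lift ![q.1, q.2] p.2 = FreeGroup.of (1 : Fin 2)) :
    IsBasisPair (FreeGroup.lift ![x, y] p.1) (FreeGroup.lift ![x, y] p.2) := by
  obtain ⟨e, rfl, rfl⟩ := h
  have he : (FreeGroup.lift ![e (FreeGroup.of 0), e (FreeGroup.of 1)] : F₂ →* F₂) =
      e.toMonoidHom := by
    ext i
    fin_cases i <;> simp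
  refine ⟨(MonoidHom.toMulEquiv (FreeGroup.lift ![p.1, p.2]) (FreeGroup.lift ![q.1, q.2])
    ?_ ?_).trans e, ?_, ?_⟩
  · ext i
    fin_cases i <;> simp [h3, h4]
  · ext i
    fin_cases i <;> simp [h1, h2]
  · rw [he]; simp
  · rw [he]; simp

theorem IsBasisPair.mul_left {x y : F₂} (h : IsBasisPair x y) : IsBasisPair (x * y) y := by
  simpa using h.change (.of 0 * .of 1, .of 1) (.of 0 * (.of 1)⁻¹, .of 1)
    (by simp) (by simp) (by simp) (by simp)

theorem IsBasisPair.mul_right {x y : F₂} (h : IsBasisPair x y) : IsBasisPair x (x * y) := by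
  simpa using h.change (.of 0, .of 0 * .of 1) (.of 0, (.of 0)⁻¹ * .of 1)
    (by simp) (by simp) (by simp) (by simp)

theorem IsBasisPair.inv_left {x y : F₂} (h : IsBasisPair x y) : IsBasisPair x⁻¹ y := by
  simpa using h.change ((.of 0)⁻¹, .of 1) ((.of 0)⁻¹, .of 1)
    (by simp) (by simp) (by simp) (by simp)

theorem IsBasisPair.inv_right {x y : F₂} (h : IsBasisPair x y) : IsBasisPair x y⁻¹ := by
  simpa using h.change (.of 0, (.of 1)⁻¹) (.of 0, (.of 1)⁻¹)
    (by simp) (by simp) (by simp) (by simp)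

theorem IsBasisPair.mul_pow {x y : F₂} (h : IsBasisPair x y) (k : ℕ) :
    IsBasisPair (x * y ^ k) y := by
  induction k with
  | zero => simpa using h
  | succ k ih => simpa [pow_succ, mul_assoc] using ih.mul_left

theorem IsBasisPair.pow_mul {x y : F₂} (h : IsBasisPair x y) (k : ℕ) :
    IsBasisPair x (x ^ k * y) := by
  induction k with
  | zero => simpa using h
  | succ k ih => simpa [pow_succ', mul_assoc] using ih.mul_right

/-- This height counts letters on positive words in x and y, and so measures how far a basis has
moved. -/
theorem IsBasisPair.exists_hom {x y : F₂} (h : IsBasisPair x y) :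
    ∃ φ : F₂ →* Multiplicative ℤ, φ x = .ofAdd 1 ∧ φ y = .ofAdd 1 := by
  obtain ⟨e, rfl, rfl⟩ := h
  exact ⟨(FreeGroup.lift fun _ => .ofAdd 1).comp e.symm.toMonoidHom, by simp, by simp⟩

/-- A homomorphism to `ℤ` is bounded on finitely many classes of primitive elements. -/
theorem exists_bound_of_finite (φ : F₂ →* Multiplicative ℤ) {S : Set PrimitiveClass}
    (hS : S.Finite) : ∃ N : ℤ, ∀ γ : {γ : F₂ // IsPrimitive γ},
      Quotient.mk primitiveSetoid γ ∈ S → |(φ γ.1).toAdd| ≤ N := by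
  have hconj : ∀ {a b : F₂}, IsConj a b → φ a = φ b := fun hab =>
    isConj_iff_eq.1 (φ.map_isConj hab)
  -- Conjugation is invisible in the abelian target and inversion only changes the sign.
  let ψ : PrimitiveClass → ℤ := Quotient.lift (fun γ => |(φ γ.1).toAdd|) (by
    rintro a b (hab | hab)
    · simp only [hconj hab]
    · simp only [hconj hab, map_inv, toAdd_inv, abs_neg])
  obtain ⟨N, hN⟩ := (hS.image ψ).bddAbove
  exact ⟨N, fun γ hγ => hN ⟨_, hγ, rfl⟩⟩

/-! ### Mixed bases: growth of the height and descent -/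

/-- `(x, y)` is a basis on which `β` takes values of opposite signs, and `φ > N`. -/
structure IsMixedPair (β : F₂ → ℝ) (φ : F₂ →* Multiplicative ℤ) (N : ℤ) (x y : F₂) : Prop where
  isBasisPair : IsBasisPair x y
  pos : 0 < β x
  neg : β y < 0
  left : N < (φ x).toAdd
  right : N < (φ y).toAdd

variable {β : F₂ → ℝ} {D : ℝ}

theorem exists_isMixedPair (hinv : ∀ g, β g⁻¹ = -β g) (h0 : ∀ g, IsPrimitive g → β g ≠ 0) :
    ∃ φ x y, IsMixedPair β φ 0 x y := by
  obtain ⟨x, y, h, hx, hy⟩ : ∃ x y, IsBasisPair x y ∧ 0 < β x ∧ β y < 0 := by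
    have hb := isBasisPair_of
    rcases lt_or_gt_of_ne (h0 _ hb.isPrimitive_left) with h1 | h1 <;>
    rcases lt_or_gt_of_ne (h0 _ hb.isPrimitive_right) with h2 | h2
    · exact ⟨_, _, hb.inv_left, by rw [hinv]; linarith, h2⟩
    · exact ⟨_, _, hb.inv_left.inv_right, by rw [hinv]; linarith, by rw [hinv]; linarith⟩
    · exact ⟨_, _, hb, h1, h2⟩
    · exact ⟨_, _, hb.inv_right, h1, by rw [hinv]; linarith⟩
  obtain ⟨φ, h1, h2⟩ := h.exists_hom
  exact ⟨φ, x, y, h, hx, hy, by rw [h1]; exact one_pos, by rw [h2]; exact one_pos⟩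

variable (hq : IsQuasimorphism β D) (hpow : ∀ g (k : ℕ), β (g ^ k) = k * β g)
  (h0 : ∀ g, IsPrimitive g → β g ≠ 0) {φ : F₂ →* Multiplicative ℤ}

include hq hpow h0 in
-- Since β y < 0, β (x y ^ k) is eventually negative. At the first such k, x y ^ (k - 1) and x y ^ k
-- form a mixed basis, and the second entry has strictly gained height over x.
theorem IsMixedPair.exists_right {N M : ℤ} (hN : 0 ≤ N) {x y : F₂} (h : IsMixedPair β φ N x y)
    (hM : M ≤ (φ x).toAdd) : ∃ x' y', IsMixedPair β φ N x' y' ∧ M ≤ (φ x').toAdd ∧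
      M < (φ y').toAdd := by
  have hex : ∃ k : ℕ, β (x * y ^ k) < 0 := by
    obtain ⟨k, hk⟩ := exists_nat_gt ((β x + D) / -β y)
    rw [div_lt_iff₀ (by linarith [h.neg])] at hk
    have := (abs_le.1 (hq x (y ^ k))).2
    rw [hpow] at this
    exact ⟨k, by linarith⟩
  have hk := Nat.find_spec hex
  have hmin := fun m => Nat.find_min hex (m := m)
  set k := Nat.find hex
  have hk0 : k ≠ 0 := fun e => by
    rw [e, pow_zero, mul_one] at hk
    linarith [h.pos]
  obtain ⟨m, hm⟩ := Nat.exists_eq_succ_of_ne_zero hk0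
  have hb := h.isBasisPair.mul_pow m
  have hφ : (φ (x * y ^ m)).toAdd = (φ x).toAdd + m * (φ y).toAdd := by simp
  have hφ' : (φ (x * y ^ m * y)).toAdd = (φ x).toAdd + m * (φ y).toAdd + (φ y).toAdd := by simp
  have hnn : 0 ≤ (m : ℤ) * (φ y).toAdd := mul_nonneg (by positivity) (by linarith [h.right])
  have hl := h.left
  have hr := h.right
  refine ⟨x * y ^ m, x * y ^ m * y, ⟨hb.mul_right, ?_, ?_, ?_, ?_⟩, ?_, ?_⟩
  · exact lt_of_le_of_ne (not_lt.1 (hmin m (by omega))) (h0 _ hb.isPrimitive_left).symm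
  · rw [mul_assoc, ← pow_succ, ← Nat.succ_eq_add_one, ← hm]; exact hk
  all_goals omega

include hq hpow h0 in
theorem IsMixedPair.exists_left {N M : ℤ} (hN : 0 ≤ N) {x y : F₂} (h : IsMixedPair β φ N x y)
    (hM : M ≤ (φ y).toAdd) : ∃ x' y', IsMixedPair β φ N x' y' ∧ M < (φ x').toAdd ∧
      M ≤ (φ y').toAdd := by
  have hex : ∃ k : ℕ, 0 < β (x ^ k * y) := by
    obtain ⟨k, hk⟩ := exists_nat_gt ((-β y + D) / β x)
    rw [div_lt_iff₀ h.pos] at hk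
    have := (abs_le.1 (hq (x ^ k) y)).1
    rw [hpow] at this
    exact ⟨k, by linarith⟩
  have hk := Nat.find_spec hex
  have hmin := fun m => Nat.find_min hex (m := m)
  set k := Nat.find hex
  have hk0 : k ≠ 0 := fun e => by
    rw [e, pow_zero, one_mul] at hk
    linarith [h.neg]
  obtain ⟨m, hm⟩ := Nat.exists_eq_succ_of_ne_zero hk0
  have hb := h.isBasisPair.pow_mul m
  have hφ : (φ (x ^ m * y)).toAdd = m * (φ x).toAdd + (φ y).toAdd := by simp
  have hφ' : (φ (x * (x ^ m * y))).toAdd = (φ x).toAdd + (m * (φ x).toAdd + (φ y).toAdd) := by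
    simp
  have hnn : 0 ≤ (m : ℤ) * (φ x).toAdd := mul_nonneg (by positivity) (by linarith [h.left])
  have hl := h.left
  have hr := h.right
  refine ⟨x * (x ^ m * y), x ^ m * y, ⟨hb.mul_left, ?_, ?_, ?_, ?_⟩, ?_, ?_⟩
  · rw [← mul_assoc, ← pow_succ', ← Nat.succ_eq_add_one, ← hm]; exact hk
  · exact lt_of_le_of_ne (not_lt.1 (hmin m (by omega))) (h0 _ hb.isPrimitive_right)
  all_goals omega

include hq hpow h0 in
/-- There are mixed pairs with `φ` arbitrarily large. -/
theorem IsMixedPair.exists_large {x y : F₂} (h : IsMixedPair β φ 0 x y) (N : ℕ) :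
    ∃ x' y', IsMixedPair β φ N x' y' := by
  induction N with
  | zero => exact ⟨x, y, by exact_mod_cast h⟩
  | succ N ih =>
    obtain ⟨x, y, h⟩ := ih
    have hl := h.left
    -- Each move guarantees a strict gain in one entry only, so both kinds are used. The first
    -- leaves the height of y at least N + 2, the threshold for the second.
    obtain ⟨x, y, h, h1, h2⟩ := h.exists_right hq hpow h0 (M := N + 1) (by positivity) hl
    obtain ⟨x, y, h', h3, h4⟩ := h.exists_left hq hpow h0 (M := N + 2) (by positivity) (by omega)
    exact ⟨x, y, h'.isBasisPair, h'.pos, h'.neg, by push_cast; omega, by push_cast; omega⟩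

include hq h0 in
/-- A descent: mixed pairs cannot all have large values. -/
theorem IsMixedPair.false_of_large {K : ℝ} {N : ℤ} (hN : 0 ≤ N)
    (hlarge : ∀ g, IsPrimitive g → N < (φ g).toAdd → K < |β g|) (n : ℕ) {x y : F₂}
    (h : IsMixedPair β φ N x y) (hn : β x - β y < n * (K - D)) : False := by
  induction n generalizing x y with
  | zero =>
    rw [Nat.cast_zero, zero_mul] at hn
    linarith [h.pos, h.neg]
  | succ n ih =>
    have hx := hlarge x h.isBasisPair.isPrimitive_left h.left
    have hy := hlarge y h.isBasisPair.isPrimitive_right h.right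
    rw [abs_of_pos h.pos] at hx
    rw [abs_of_neg h.neg] at hy
    have hq' := abs_le.1 (hq x y)
    have hb := h.isBasisPair.mul_left
    have hφ : N < (φ (x * y)).toAdd := by
      have := h.left
      have := h.right
      rw [map_mul, toAdd_mul]
      omega
    push_cast at hn
    -- The product replaces the entry whose sign it shares. The drop in β x - β y is then at least
    -- the absolute value of β on the retained entry minus D, hence more than K - D.
    rcases lt_or_gt_of_ne (h0 _ hb.isPrimitive_left) with hs | hs
    · exact ih ⟨h.isBasisPair.mul_right, h.pos, hs, h.left, hφ⟩ (by linarith)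
    · exact ih ⟨hb, hs, h.neg, hφ, h.right⟩ (by linarith)

include hq hpow h0 in
/-- A homogeneous quasimorphism of defect less than `K` that does not vanish on primitive
elements takes values in `[-K, K]` on infinitely many classes of primitive elements. -/
theorem IsQuasimorphism.infinite_primitiveClass (hinv : ∀ g, β g⁻¹ = -β g) {K : ℝ}
    (hDK : D < K) : {c : PrimitiveClass | ∃ γ : {γ : F₂ // IsPrimitive γ},
      Quotient.mk primitiveSetoid γ = c ∧ |β γ.1| ≤ K}.Infinite := by
  intro hS
  obtain ⟨φ, x, y, h⟩ := exists_isMixedPair hinv h0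
  obtain ⟨N, hN⟩ := exists_bound_of_finite φ hS
  obtain ⟨x, y, h⟩ := h.exists_large hq hpow h0 N.toNat
  have hlarge : ∀ g, IsPrimitive g → (N.toNat : ℤ) < (φ g).toAdd → K < |β g| := by
    intro g hg hφ
    by_contra! hle
    have h1 := hN ⟨g, hg⟩ ⟨⟨g, hg⟩, rfl, hle⟩
    have h2 := le_abs_self (φ g).toAdd
    have h3 := Int.self_le_toNat N
    exact absurd hφ (not_lt.2 (h2.trans (h1.trans h3)))
  obtain ⟨n, hn⟩ := exists_nat_gt ((β x - β y) / (K - D))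
  rw [div_lt_iff₀ (sub_pos.2 hDK)] at hn
  exact h.false_of_large hq h0 (by positivity) hlarge n hn

end FreeGroup

end Bowditch

theorem mainTheorem6 {X : Type*} [MetricSpace X] [Nonempty X] (δ : ℝ) (hδ : 0 < δ)
    (hgeo : Bowditch.IsGeodesicSpace X) (hhyp : Bowditch.IsRipsHyperbolic X δ)
    (hvis : Bowditch.IsVisibilitySpace X)
    (ρ : Bowditch.F₂ →* (X ≃ᵢ X)) (hρ : Bowditch.SatisfiesBQa δ ρ) :
    Bowditch.IsIrreducible ρ := by
  rintro ⟨ξ, hξ⟩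
  obtain ⟨u, rfl⟩ := Quot.exists_rep ξ
  have hX := hhyp.isGromovHyperbolic hδ.le hgeo
  have x : X := Classical.arbitrary X
  have hq := hX.isQuasimorphism_busemann hξ x
  have hle := hX.stableNorm_le hξ x
  -- The four point constant 3δ gives defect 6δ for the Busemann quasimorphism and 24δ after
  -- homogenization, well below 433δ.
  refine hq.isQuasimorphism_homogenization.infinite_primitiveClass hq.homogenization_pow
    (fun g hg he => ?_) hq.homogenization_inv (K := 433 * δ) (by linarith) (hρ.2.subset ?_)
  · have := (hρ.1 g hg).stableNorm_pos.trans_le (hle g)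
    rw [he, abs_zero] at this
    exact this.false
  · rintro c ⟨γ, hγ, hK⟩
    exact ⟨γ, hγ, (hle γ.1).trans hK⟩
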